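/- For complex $a,q$ and an integer $n\ge 0$ write $(a;q)_n=\prod_{k=0}^{n-1}(1-aq^k)$. Let $q\in\mathbb{C}$ with $|q|<1$. Then all of the series below converge absolutely, and the following four identities hold: $$\sum_{n=0}^{\infty}\frac{(1-q^{n+1})(q^3;q^3)_n(-1)^nq^{n(n+1)/2}}{(q;q)_{2n+2}}=\sum_{r=0}^{\infty}q^{9r^2+3r}(1-q^{12r+6})+\sum_{r=0}^{\infty}q^{9r^2+12r+4}(1-q^{-6r-3}),$$ $$\sum_{n=0}^{\infty}\frac{(-1)^nq^{n^2+n}}{(-q;q)_{2n}}=\sum_{r=0}^{\infty}q^{10r^2+r}(1-q^{18r+9})+\sum_{r=0}^{\infty}q^{10r^2+11r+3}(1-q^{-2r-1}),$$ $$\sum_{n=0}^{\infty}\frac{(q;q)_{n+1}(-q^2;q^2)_n(-1)^nq^{(n^2+n)/2}}{(q;q)_{2n+2}}=\sum_{r=0}^{\infty}q^{16r^2+4r}(1-q^{24r+12})-\sum_{r=0}^{\infty}q^{16r^2+8r+1}(1-q^{16r+8})+\sum_{r=0}^{\infty}q^{16r^2+12r+2}(1-q^{8r+4}),$$ $$\sum_{n=0}^{\infty}\frac{(-q;q)_nq^{n(n+1)/2}(-1)^n}{(q;q^2)_{n+1}}=\sum_{r=0}^{\infty}(-1)^rq^{r^2+r}.$$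 (For $q=0$, the terms $q^{9r^2+12r+4}(1-q^{-6r-3})$ and $q^{10r^2+11r+3}(1-q^{-2r-1})$ are read as $q^{9r^2+12r+4}-q^{9r^2+6r+1}$ and $q^{10r^2+11r+3}-q^{10r^2+9r+2}$, that is, as $0$.) -/

import Mathlib

/-- The `q`-shifted factorial `(a;q)_n = (1 - a)(1 - a q) ⋯ (1 - a q^(n-1))`. -/
def qPoch (a q : ℂ) (n : ℕ) : ℂ :=
  ∏ k ∈ Finset.range n, (1 - a * q ^ k)

/-!
For a Bailey pair relative to `q`, normalised as
`∑_{r ≤ n} α_r / ((q;q)_{n-r} (q;q)_{n+r+1}) = β_n`, Bailey's lemma with the parameters `q` and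
`ρ → ∞` reads `∑ (q;q)_n (-1)^n q^(n(n+1)/2) β_n = ∑ (-1)^r q^(r(r+1)/2) α_r`.

With `X = x + 1/x`, the sequence `β_n = (xq;q)_n (q/x;q)_n / (q;q)_{2n+1}` belongs to
`α_r = (-1)^r q^(r(r+1)/2) (S_r(X) + S_{r-1}(X))`, where `S_r` are the Chebyshev polynomials;
`X = -2` gives the fourth identity. Dividing `β_n` by `1 + q^(n+1)` produces a further Bailey pair,
whose series is `∑ q^(r²+r) (1 - q^(r+1) + q^(2r+2)) S_r(X)`. At `X = -1` and `X = 0` the product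
`(xq;q)_n (q/x;q)_n` is `(q³;q³)_n / (q;q)_n` and `(-q²;q²)_n`, and `S_r(X)` has period `3` and `4`
in `r`; sorting `r` by residues gives the first and third identities. The second comes in the same
way from a Bailey pair for the base `q²` with `β_n = 1 / ((q²;q²)_n (-q;q)_{2n})`, sorting `r` by
parity.
-/

open Filter Finset Topology

theorem qPoch_zero (a q : ℂ) : qPoch a q 0 = 1 := by simp [qPoch]

theorem qPoch_succ (a q : ℂ) (n : ℕ) : qPoch a q (n + 1) = qPoch a q n * (1 - a * q ^ n) :=
  prod_range_succ _ n

theorem qPoch_self_succ (q : ℂ) (n : ℕ) :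
    qPoch q q (n + 1) = qPoch q q n * (1 - q ^ (n + 1)) := by
  rw [qPoch_succ, pow_succ']

section NonVanishing

variable {q : ℂ} (hq : ‖q‖ < 1)
include hq

theorem pow_succ_ne_of_norm_eq_one {z : ℂ} (hz : ‖z‖ = 1) (n : ℕ) : q ^ (n + 1) ≠ z := by
  rintro rfl
  exact (pow_lt_one₀ (norm_nonneg q) hq n.succ_ne_zero).ne (norm_pow q _ ▸ hz)

theorem one_sub_pow_succ_ne_zero (n : ℕ) : 1 - q ^ (n + 1) ≠ 0 :=
  sub_ne_zero.mpr (pow_succ_ne_of_norm_eq_one hq norm_one n).symm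

theorem one_add_pow_ne_zero (n : ℕ) : 1 + q ^ n ≠ 0 := by
  cases n with
  | zero => norm_num
  | succ n =>
    rw [add_comm, Ne, add_eq_zero_iff_eq_neg]
    exact pow_succ_ne_of_norm_eq_one hq (by simp) n

theorem qPoch_self_ne_zero (n : ℕ) : qPoch q q n ≠ 0 :=
  prod_ne_zero_iff.mpr fun k _ => by
    rw [← pow_succ']
    exact one_sub_pow_succ_ne_zero hq k

theorem qPoch_neg_self_ne_zero (n : ℕ) : qPoch (-q) q n ≠ 0 :=
  prod_ne_zero_iff.mpr fun k _ => by
    rw [neg_mul, sub_neg_eq_add, ← pow_succ']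
    exact one_add_pow_ne_zero hq (k + 1)

theorem exists_tendsto_qPoch_self : ∃ L ≠ 0, Tendsto (qPoch q q) atTop (𝓝 L) := by
  have hprod := (ModularForm.multipliable_one_sub_pow hq).hasProd.tendsto_prod_nat
  refine ⟨_, ?_, hprod.congr fun n => ?_⟩
  · simp only [sub_eq_add_neg]
    refine tprod_one_add_ne_zero_of_summable (fun n => ?_) ?_
    · simpa only [sub_eq_add_neg] using one_sub_pow_succ_ne_zero hq n
    · simpa only [norm_neg, norm_pow] using
        (summable_nat_add_iff 1).mpr (summable_geometric_of_lt_one (norm_nonneg q) hq)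
  · simp only [qPoch, pow_succ']

theorem exists_norm_qPoch_self_le : ∃ C, ∀ n, ‖qPoch q q n‖ ≤ C := by
  obtain ⟨L, -, hL⟩ := exists_tendsto_qPoch_self hq
  simpa using (Metric.isBounded_range_of_tendsto _ hL).exists_norm_le

theorem exists_norm_inv_qPoch_self_le : ∃ C, ∀ n, ‖(qPoch q q n)⁻¹‖ ≤ C := by
  obtain ⟨L, hL0, hL⟩ := exists_tendsto_qPoch_self hq
  simpa using (Metric.isBounded_range_of_tendsto _ (hL.inv₀ hL0)).exists_norm_le

end NonVanishing

/-- The factor `(-1)^n q^(n(n-1)/2)` of basic hypergeometric series. -/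
def qSign (q : ℂ) (n : ℕ) : ℂ :=
  (-1) ^ n * q ^ n.choose 2

theorem qSign_zero (q : ℂ) : qSign q 0 = 1 := by simp [qSign]

theorem qSign_succ (q : ℂ) (n : ℕ) : qSign q (n + 1) = -(q ^ n * qSign q n) := by
  rw [qSign, qSign, Nat.choose_succ_succ', Nat.choose_one_right, pow_succ, pow_add]
  ring

theorem qSign_mul_qSign (p q : ℂ) (n : ℕ) : qSign p n * qSign q n = (p * q) ^ n.choose 2 := by
  rw [qSign, qSign, mul_mul_mul_comm, ← mul_pow, ← mul_pow, neg_one_mul, neg_neg, one_pow, one_mul]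

theorem norm_qSign_add_le {q : ℂ} (hq : ‖q‖ ≤ 1) (r s : ℕ) : ‖qSign q (r + s)‖ ≤ ‖qSign q r‖ := by
  simp only [qSign, norm_mul, norm_pow, norm_neg, norm_one, one_pow, one_mul]
  exact pow_le_pow_of_le_one (norm_nonneg q) hq (Nat.choose_le_choose 2 (Nat.le_add_right r s))

/-- The matrix `1 / ((q;q)_{n-r} (q;q)_{n+r+1})`, with `r ≤ n`, relating the two halves of a Bailey
pair relative to `a = q`. It is extended by zero to `r > n`, where `n - r` would be truncated. -/
noncomputable def baileyKernel (q : ℂ) (n r : ℕ) : ℂ :=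
  if r ≤ n then (qPoch q q (n - r) * qPoch q q (n + r + 1))⁻¹ else 0

theorem baileyKernel_of_lt (q : ℂ) {n r : ℕ} (h : n < r) : baileyKernel q n r = 0 :=
  if_neg h.not_ge

theorem baileyKernel_of_le (q : ℂ) {n r : ℕ} (h : r ≤ n) :
    baileyKernel q n r = (qPoch q q (n - r) * qPoch q q (n + r + 1))⁻¹ :=
  if_pos h

section KernelRecurrences

variable {q : ℂ} (hq : ‖q‖ < 1) (n r : ℕ)
include hq

theorem baileyKernel_eq_mul_succ_left :
    baileyKernel q n r =
      (1 - q ^ (n + 1 - r)) * (1 - q ^ (n + r + 2)) * baileyKernel q (n + 1) r := by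
  rcases lt_trichotomy r (n + 1) with h | rfl | h
  · have hr : r ≤ n := Nat.le_of_lt_succ h
    rw [baileyKernel_of_le q hr, baileyKernel_of_le q h.le, Nat.succ_sub hr, Nat.succ_eq_add_one,
      show n + 1 + r + 1 = n + r + 1 + 1 by ring, qPoch_self_succ q (n - r),
      qPoch_self_succ q (n + r + 1)]
    have := one_sub_pow_succ_ne_zero hq (n - r)
    have := one_sub_pow_succ_ne_zero hq (n + r + 1)
    field_simp
  · simp [baileyKernel_of_lt]
  · simp [baileyKernel_of_lt, h, (Nat.lt_succ_self n).trans h]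

theorem mul_baileyKernel_succ_right :
    (1 - q ^ (n + r + 2)) * baileyKernel q n (r + 1) = (1 - q ^ (n - r)) * baileyKernel q n r := by
  rcases lt_trichotomy n r with h | rfl | h
  · simp [baileyKernel_of_lt, h, Nat.lt_succ_of_lt h]
  · simp [baileyKernel_of_lt]
  · obtain ⟨s, rfl⟩ := Nat.exists_eq_add_of_lt h
    rw [baileyKernel_of_le q h.le, baileyKernel_of_le q h, show r + s + 1 - r = s + 1 by omega,
      show r + s + 1 - (r + 1) = s by omega, ← add_assoc (r + s + 1) r 1, qPoch_self_succ q s,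
      qPoch_self_succ q (r + s + 1 + r + 1)]
    have := one_sub_pow_succ_ne_zero hq s
    have := one_sub_pow_succ_ne_zero hq (r + s + 1 + r + 1)
    field_simp

theorem baileyKernel_eq_mul_succ_succ :
    baileyKernel q n r =
      (1 - q ^ (n + r + 2)) * (1 - q ^ (n + r + 3)) * baileyKernel q (n + 1) (r + 1) := by
  rw [baileyKernel_eq_mul_succ_left hq, mul_right_comm, ← mul_baileyKernel_succ_right hq]
  ring

theorem baileyKernel_succ_right_eq_mul :
    baileyKernel q n (r + 1) =
      (1 - q ^ (n - r)) * (1 - q ^ (n + 1 - r)) * baileyKernel q (n + 1) r := by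
  refine mul_left_cancel₀ (one_sub_pow_succ_ne_zero hq (n + r + 1)) ?_
  rw [mul_baileyKernel_succ_right hq, baileyKernel_eq_mul_succ_left hq n r]
  ring

end KernelRecurrences

/-- The weight `(q;q)_n (-1)^n q^(n(n+1)/2)`: up to a constant it is the `δ_n` of the conjugate
Bailey pair obtained from the parameters `q` and `ρ → ∞`. -/
def baileyWeight (q : ℂ) (n : ℕ) : ℂ :=
  qPoch q q n * (qSign q n * q ^ n)

theorem baileyWeight_succ (q : ℂ) (n : ℕ) :
    baileyWeight q (n + 1) = -(q ^ (n + 1) * (1 - q ^ (n + 1)) * baileyWeight q n) := by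
  rw [baileyWeight, baileyWeight, qSign_succ, qPoch_self_succ]
  ring

section ConjugatePair

variable {q : ℂ} (hq : ‖q‖ < 1)
include hq

theorem exists_norm_baileyWeight_mul_kernel_le :
    ∃ C, ∀ r s, ‖baileyWeight q (r + s) * baileyKernel q (r + s) r‖ ≤
      C * ‖qSign q r * q ^ r‖ * ‖q‖ ^ s := by
  obtain ⟨A, hA⟩ := exists_norm_qPoch_self_le hq
  obtain ⟨B, hB⟩ := exists_norm_inv_qPoch_self_le hq
  have hA0 := (norm_nonneg _).trans (hA 0)
  have hB0 := (norm_nonneg _).trans (hB 0)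
  refine ⟨A * (B * B), fun r s => ?_⟩
  rw [baileyWeight, baileyKernel_of_le q (Nat.le_add_right r s), mul_inv]
  simp only [norm_mul]
  calc _ ≤ A * (‖qSign q r‖ * ‖q ^ (r + s)‖) * (B * B) := by
        gcongr
        exacts [hA _, norm_qSign_add_le hq.le r s, hB _, hB _]
    _ = _ := by rw [pow_add, norm_mul, norm_pow q s]; ring

theorem summable_baileyWeight_mul_kernel (r : ℕ) :
    Summable fun n => baileyWeight q n * baileyKernel q n r := by
  obtain ⟨C, hC⟩ := exists_norm_baileyWeight_mul_kernel_le hq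
  refine (summable_nat_add_iff r).mp (Summable.of_norm_bounded
    ((summable_geometric_of_lt_one (norm_nonneg q) hq).mul_left (C * ‖qSign q r * q ^ r‖))
    fun s => ?_)
  rw [add_comm s r]
  exact hC r s

theorem sum_range_baileyWeight_mul_kernel_zero (N : ℕ) :
    ∑ n ∈ range N, baileyWeight q n * baileyKernel q n 0 =
      1 - (1 - q ^ (N + 1)) * (baileyWeight q N * baileyKernel q N 0) := by
  induction N with
  | zero =>
    have h := one_sub_pow_succ_ne_zero hq 0
    rw [zero_add, pow_one] at h
    simp [baileyKernel, baileyWeight, qSign, qPoch, h]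
  | succ N ih =>
    rw [sum_range_succ, ih, baileyKernel_eq_mul_succ_left hq N 0, baileyWeight_succ, add_zero,
      Nat.sub_zero]
    ring

theorem sum_range_baileyWeight_mul_kernel_succ (r N : ℕ) :
    ∑ n ∈ range N, baileyWeight q n *
        (q ^ (r + 1) * baileyKernel q n r + baileyKernel q n (r + 1)) =
      -((1 + q ^ (r + 1)) * (1 - q ^ (N - r)) * (baileyWeight q N * baileyKernel q N r)) := by
  induction N with
  | zero => simp
  | succ N ih =>
    rcases lt_or_ge N r with h | h
    · simp [sum_range_succ, ih, baileyKernel_of_lt, h, Nat.lt_succ_of_lt h, Nat.sub_eq_zero_of_le,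
        Nat.succ_le_of_lt h]
    · obtain ⟨s, rfl⟩ := Nat.exists_eq_add_of_le h
      rw [sum_range_succ, ih, baileyKernel_succ_right_eq_mul hq,
        baileyKernel_eq_mul_succ_left hq (r + s), baileyWeight_succ, show r + s - r = s by omega,
        show r + s + 1 - r = s + 1 by omega]
      ring

theorem hasSum_baileyWeight_mul_kernel_zero :
    HasSum (fun n => baileyWeight q n * baileyKernel q n 0) 1 := by
  have hsum := summable_baileyWeight_mul_kernel hq 0
  have hpow := (tendsto_pow_atTop_nhds_zero_of_norm_lt_one hq).comp (tendsto_add_atTop_nat 1)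
  rw [hsum.hasSum_iff_tendsto_nat]
  simp_rw [sum_range_baileyWeight_mul_kernel_zero hq]
  simpa using ((hpow.const_sub 1).mul hsum.tendsto_atTop_zero).const_sub 1

theorem hasSum_baileyWeight_mul_kernel_succ (r : ℕ) :
    HasSum (fun n => baileyWeight q n *
      (q ^ (r + 1) * baileyKernel q n r + baileyKernel q n (r + 1))) 0 := by
  have hsum := summable_baileyWeight_mul_kernel hq
  have hpow := (tendsto_pow_atTop_nhds_zero_of_norm_lt_one hq).comp (tendsto_sub_atTop_nat r)
  rw [Summable.hasSum_iff_tendsto_nat]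
  · simp_rw [sum_range_baileyWeight_mul_kernel_succ hq]
    simpa using
      (((hpow.const_sub 1).const_mul (1 + q ^ (r + 1))).mul (hsum r).tendsto_atTop_zero).neg
  · exact (((hsum r).mul_left (q ^ (r + 1))).add (hsum (r + 1))).congr fun n => by ring

theorem hasSum_baileyWeight_mul_kernel (r : ℕ) :
    HasSum (fun n => baileyWeight q n * baileyKernel q n r) (qSign q r * q ^ r) := by
  induction r with
  | zero => simpa [qSign_zero] using hasSum_baileyWeight_mul_kernel_zero hq
  | succ r ih =>
    have hsub := (hasSum_baileyWeight_mul_kernel_succ hq r).sub (ih.mul_left (q ^ (r + 1)))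
    rw [show qSign q (r + 1) * q ^ (r + 1) = 0 - q ^ (r + 1) * (qSign q r * q ^ r) by
      rw [qSign_succ]; ring]
    exact hsub.congr_fun fun n => by ring

end ConjugatePair

/-- `(α, β)` is a Bailey pair relative to `a = q`. The usual kernel `1 / ((q;q)_{n-r} (q²;q)_{n+r})`
is `(1 - q) * baileyKernel q n r`; the constant `1 - q` is dropped. -/
def IsBaileyPair (q : ℂ) (α β : ℕ → ℂ) : Prop :=
  ∀ n, ∑ r ∈ range (n + 1), α r * baileyKernel q n r = β n

theorem summable_prod_of_summable_add {M : Type*} [AddCommMonoid M] [TopologicalSpace M]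
    {F : ℕ × ℕ → M} (hzero : ∀ n r, n < r → F (n, r) = 0)
    (hF : Summable fun x : ℕ × ℕ => F (x.1 + x.2, x.1)) : Summable F := by
  have hinj : Function.Injective fun x : ℕ × ℕ => (x.1 + x.2, x.1) := fun x y hxy => by
    simp only [Prod.mk.injEq] at hxy
    ext <;> omega
  refine (hinj.summable_iff fun x hx => hzero _ _ ?_).mp hF
  by_contra! hle
  exact hx ⟨(x.2, x.1 - x.2), by ext <;> simp [hle]⟩

theorem summable_baileyWeight_mul_kernel_mul {q : ℂ} (hq : ‖q‖ < 1) {α : ℕ → ℂ}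
    (hα : Summable fun r => qSign q r * q ^ r * α r) :
    Summable fun x : ℕ × ℕ => baileyWeight q x.1 * baileyKernel q x.1 x.2 * α x.2 := by
  refine summable_prod_of_summable_add (fun n r h => by simp [baileyKernel_of_lt q h]) ?_
  obtain ⟨C, hC⟩ := exists_norm_baileyWeight_mul_kernel_le hq
  refine Summable.of_norm_bounded ((hα.norm.mul_of_nonneg
    (summable_geometric_of_lt_one (norm_nonneg q) hq) (fun r => norm_nonneg _)
    fun s => by positivity).mul_left C) fun x => ?_
  rw [norm_mul]
  refine (mul_le_mul_of_nonneg_right (hC x.1 x.2) (norm_nonneg _)).trans_eq ?_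
  rw [norm_mul _ (α x.1)]
  ring

/-- Bailey's lemma, for the parameters `q` and `ρ → ∞`. -/
theorem IsBaileyPair.hasSum {q : ℂ} (hq : ‖q‖ < 1) {α β : ℕ → ℂ} (h : IsBaileyPair q α β) {S : ℂ}
    (hS : HasSum (fun r => qSign q r * q ^ r * α r) S) :
    HasSum (fun n => baileyWeight q n * β n) S := by
  obtain ⟨T, hT⟩ := summable_baileyWeight_mul_kernel_mul hq hS.summable
  have hrow (n : ℕ) : HasSum (fun r => baileyWeight q n * baileyKernel q n r * α r)
      (baileyWeight q n * β n) := by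
    have hfin : HasSum (fun r => baileyWeight q n * baileyKernel q n r * α r)
        (∑ r ∈ range (n + 1), baileyWeight q n * baileyKernel q n r * α r) :=
      hasSum_sum_of_ne_finset_zero fun r hr => by
        simp [baileyKernel_of_lt q (not_lt.mp (mt mem_range.mpr hr))]
    convert hfin using 1
    rw [← h n, mul_sum]
    exact sum_congr rfl fun r _ => by ring
  have hcol (r : ℕ) : HasSum (fun n => baileyWeight q n * baileyKernel q n r * α r)
      (qSign q r * q ^ r * α r) :=
    (hasSum_baileyWeight_mul_kernel hq r).mul_right (α r)
  have hTS : T = S := ((Equiv.prodComm ℕ ℕ).hasSum_iff.mpr hT).prod_fiberwise hcol |>.unique hS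
  exact hTS ▸ hT.prod_fiberwise hrow

theorem isBaileyPair_of_recurrence {q : ℂ} {α β a b : ℕ → ℂ}
    (h0 : α 0 * baileyKernel q 0 0 = β 0) (ha : ∀ n, a n ≠ 0)
    (hβ : ∀ n, a n * β (n + 1) = b n * β n)
    (hα : ∀ n, ∑ r ∈ range (n + 2),
      α r * (a n * baileyKernel q (n + 1) r - b n * baileyKernel q n r) = 0) :
    IsBaileyPair q α β := by
  intro n
  induction n with
  | zero => simpa using h0
  | succ n ih =>
    have hlast : ∑ r ∈ range (n + 2), α r * baileyKernel q n r = β n := by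
      rw [sum_range_succ, ih, baileyKernel_of_lt q n.lt_succ_self, mul_zero, add_zero]
    refine mul_left_cancel₀ (ha n) ?_
    rw [hβ, ← hlast, mul_sum, mul_sum, ← sub_eq_zero, ← sum_sub_distrib, ← hα n]
    exact sum_congr rfl fun r _ => by ring

section SymmetricProduct

/-- The product `(xq;q)_n (q/x;q)_n`, written in terms of `X = x + 1/x`. -/
def symmQPoch (X q : ℂ) (n : ℕ) : ℂ :=
  ∏ k ∈ range n, (1 - X * q ^ (k + 1) + q ^ (2 * (k + 1)))

theorem symmQPoch_zero (X q : ℂ) : symmQPoch X q 0 = 1 :=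
  prod_range_zero _

theorem symmQPoch_succ (X q : ℂ) (n : ℕ) :
    symmQPoch X q (n + 1) = symmQPoch X q n * (1 - X * q ^ (n + 1) + q ^ (2 * (n + 1))) :=
  prod_range_succ _ n

variable {q : ℂ} (hq : ‖q‖ < 1)
include hq

theorem mul_baileyKernel_succ_zero (n : ℕ) :
    (1 - q ^ (2 * n + 2)) * (1 - q ^ (2 * n + 3)) * baileyKernel q (n + 1) 0 =
      (1 + q ^ (n + 1) + q ^ (2 * n + 2)) * baileyKernel q n 0 +
        q ^ (n + 2) * baileyKernel q n 1 := by
  rw [baileyKernel_succ_right_eq_mul hq n 0, baileyKernel_eq_mul_succ_left hq n 0, add_zero,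
    Nat.sub_zero, Nat.sub_zero]
  ring

theorem mul_baileyKernel_succ_succ (n r : ℕ) :
    q ^ (r + 1) * ((1 - q ^ (2 * n + 2)) * (1 - q ^ (2 * n + 3)) *
        baileyKernel q (n + 1) (r + 1)) =
      q ^ (r + 1) * (1 + q ^ (2 * n + 2)) * baileyKernel q n (r + 1) +
        q ^ (n + 1) * (baileyKernel q n r + q ^ (2 * r + 3) * baileyKernel q n (r + 2)) := by
  rcases lt_or_ge n r with h | h
  · simp [baileyKernel_of_lt, h, Nat.lt_succ_of_lt h, Nat.lt_succ_of_lt (Nat.lt_succ_of_lt h)]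
  · rw [baileyKernel_succ_right_eq_mul hq n (r + 1), baileyKernel_eq_mul_succ_left hq n (r + 1),
      baileyKernel_eq_mul_succ_succ hq n r]
    obtain ⟨s, rfl⟩ := Nat.exists_eq_add_of_le h
    rcases s with - | s
    · rw [add_zero, Nat.sub_self]
      ring
    · rw [show r + (s + 1) - (r + 1) = s by omega, show r + (s + 1) + 1 - (r + 1) = s + 1 by omega]
      ring

theorem sum_range_symmQPoch_recurrence {X : ℂ} {d : ℕ → ℂ} (h1 : d 1 = (1 + X) * d 0)
    (hd : ∀ r, d (r + 2) = X * d (r + 1) - d r) (n R : ℕ) :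
    ∑ r ∈ range (R + 1), qSign q r * q ^ r * d r *
        ((1 - q ^ (2 * n + 2)) * (1 - q ^ (2 * n + 3)) * baileyKernel q (n + 1) r -
          (1 - X * q ^ (n + 1) + q ^ (2 * (n + 1))) * baileyKernel q n r) =
      q ^ (n + 1) * (qSign q R * q ^ R) *
        (d (R + 1) * baileyKernel q n R + q ^ (R + 1) * d R * baileyKernel q n (R + 1)) := by
  induction R with
  | zero =>
    rw [zero_add, range_one, sum_singleton, mul_baileyKernel_succ_zero hq, h1, qSign_zero]
    ring
  | succ R ih =>
    rw [sum_range_succ, ih, hd, qSign_succ]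
    linear_combination
      -(q ^ R * qSign q R * d (R + 1)) * mul_baileyKernel_succ_succ hq n R

theorem isBaileyPair_symmQPoch {X : ℂ} {d : ℕ → ℂ} (h0 : d 0 = 1) (h1 : d 1 = 1 + X)
    (hd : ∀ r, d (r + 2) = X * d (r + 1) - d r) :
    IsBaileyPair q (fun r => qSign q r * q ^ r * d r)
      (fun n => symmQPoch X q n / qPoch q q (2 * n + 1)) := by
  refine isBaileyPair_of_recurrence
    (a := fun n => (1 - q ^ (2 * n + 2)) * (1 - q ^ (2 * n + 3)))
    (b := fun n => 1 - X * q ^ (n + 1) + q ^ (2 * (n + 1))) ?_ (fun n => ?_) (fun n => ?_)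
    fun n => ?_
  · simp [baileyKernel, h0, qSign_zero, symmQPoch_zero, qPoch_zero]
  · exact mul_ne_zero (one_sub_pow_succ_ne_zero hq (2 * n + 1))
      (one_sub_pow_succ_ne_zero hq (2 * n + 2))
  · rw [symmQPoch_succ, show 2 * (n + 1) + 1 = 2 * n + 1 + 1 + 1 by ring, qPoch_self_succ,
      qPoch_self_succ]
    have := one_sub_pow_succ_ne_zero hq (2 * n + 1)
    have := one_sub_pow_succ_ne_zero hq (2 * n + 1 + 1)
    have := qPoch_self_ne_zero hq (2 * n + 1)
    field_simp
  · rw [sum_range_symmQPoch_recurrence hq (by rw [h1, h0, mul_one]) hd,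
      baileyKernel_of_lt q n.lt_succ_self, baileyKernel_of_lt q (by omega)]
    ring

end SymmetricProduct

theorem sum_range_one_add_pow_recurrence {q : ℂ} (hq : ‖q‖ < 1) {v : ℕ → ℂ} (h0 : v 0 = 0)
    (n R : ℕ) :
    ∑ r ∈ range R, qSign q r * q ^ r * ((1 + q ^ (n + 1)) * (v (r + 1) + q ^ r * v r) -
        ((1 + q ^ (r + 1)) * v (r + 1) + (1 + q ^ r) * v r)) * baileyKernel q n r =
      qSign q R * q ^ R * v R * ((1 - q ^ (n + R + 1)) * baileyKernel q n R) := by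
  induction R with
  | zero => simp [h0]
  | succ R ih =>
    rw [sum_range_succ, ih, ← add_assoc n R 1, add_assoc _ 1 1, mul_baileyKernel_succ_right hq,
      qSign_succ]
    rcases lt_or_ge n R with h | h
    · rw [baileyKernel_of_lt q h]
      ring
    · obtain ⟨s, rfl⟩ := Nat.exists_eq_add_of_le h
      rw [Nat.add_sub_cancel_left]
      ring

theorem IsBaileyPair.div_one_add_pow {q : ℂ} (hq : ‖q‖ < 1) {v β : ℕ → ℂ} (h0 : v 0 = 0)
    (h : IsBaileyPair q
      (fun r => qSign q r * q ^ r * ((1 + q ^ (r + 1)) * v (r + 1) + (1 + q ^ r) * v r)) β) :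
    IsBaileyPair q (fun r => qSign q r * q ^ r * (v (r + 1) + q ^ r * v r))
      (fun n => β n / (1 + q ^ (n + 1))) := by
  intro n
  have htel := sum_range_one_add_pow_recurrence hq h0 n (n + 1)
  rw [baileyKernel_of_lt q n.lt_succ_self, mul_zero, mul_zero] at htel
  rw [eq_div_iff (one_add_pow_ne_zero hq (n + 1)), ← h n, sum_mul, ← sub_eq_zero,
    ← sum_sub_distrib, ← htel]
  exact sum_congr rfl fun r _ => by ring

section Pentagonal

variable {p : ℂ} (hp : ‖p‖ < 1)
include hp

theorem norm_sq_lt_one : ‖p ^ 2‖ < 1 := by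
  rw [norm_pow]
  exact pow_lt_one₀ (norm_nonneg p) hp two_ne_zero

theorem sum_range_pentagonal_first (n R : ℕ) :
    ∑ r ∈ range R, qSign (p ^ 3) r * p ^ r * ((1 - p ^ (4 * r + 2)) -
        (1 + p ^ (2 * n + 1)) * (p ^ r * (1 - p ^ (2 * r + 1)))) * baileyKernel (p ^ 2) n r =
      -(qSign (p ^ 3) R * p ^ R * (1 - p ^ R) *
        ((1 - (p ^ 2) ^ (n + R + 1)) * baileyKernel (p ^ 2) n R)) := by
  induction R with
  | zero => simp
  | succ R ih =>
    rw [sum_range_succ, ih, ← add_assoc n R 1, add_assoc _ 1 1,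
      mul_baileyKernel_succ_right (norm_sq_lt_one hp), qSign_succ]
    rcases lt_or_ge n R with h | h
    · rw [baileyKernel_of_lt _ h]
      ring
    · obtain ⟨s, rfl⟩ := Nat.exists_eq_add_of_le h
      rw [Nat.add_sub_cancel_left]
      ring

theorem sum_range_pentagonal_second (n R : ℕ) :
    ∑ r ∈ range R, qSign (p ^ 3) r * p ^ r *
        (p ^ r * (1 - p ^ (2 * r + 1)) * baileyKernel (p ^ 2) n r -
          (1 - p ^ (4 * n + 4)) * (1 - p ^ (4 * r + 2)) * baileyKernel (p ^ 2) (n + 1) r) =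
      qSign (p ^ 3) R * (p ^ R * (1 - p ^ R) + p ^ (2 * n + 2) * (1 - p ^ (3 * R))) *
        ((1 - (p ^ 2) ^ (n + R + 2)) * baileyKernel (p ^ 2) (n + 1) R) := by
  induction R with
  | zero => simp
  | succ R ih =>
    rw [sum_range_succ, ih, show n + (R + 1) + 2 = n + 1 + R + 2 by ring,
      mul_baileyKernel_succ_right (norm_sq_lt_one hp),
      baileyKernel_eq_mul_succ_left (norm_sq_lt_one hp) n R, qSign_succ]
    rcases lt_or_ge (n + 1) R with h | h
    · rw [baileyKernel_of_lt _ h]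
      ring
    · obtain ⟨s, hs⟩ := Nat.exists_eq_add_of_le h
      rw [show 4 * n + 4 = 4 * R + 4 * s by omega, show 2 * n + 2 = 2 * R + 2 * s by omega,
        show n + 1 - R = s by omega, show n + R + 2 = 2 * R + s + 1 by omega]
      ring

theorem isBaileyPair_pentagonal :
    IsBaileyPair (p ^ 2) (fun r => qSign (p ^ 3) r * p ^ r * (1 - p ^ (4 * r + 2)))
      (fun n => (qPoch (p ^ 2) (p ^ 2) n * qPoch (-p) p (2 * n))⁻¹) := by
  have hne (n : ℕ) : (1 + p ^ (2 * n + 1)) * (1 - p ^ (4 * n + 4)) ≠ 0 :=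
    mul_ne_zero (one_add_pow_ne_zero hp _) (one_sub_pow_succ_ne_zero hp (4 * n + 3))
  refine isBaileyPair_of_recurrence (b := fun _ => 1) ?_ hne (fun n => ?_) fun n => ?_
  · have := one_sub_pow_succ_ne_zero hp 1
    norm_num at this
    simp [baileyKernel, qSign_zero, qPoch, this]
  · rw [show 2 * (n + 1) = 2 * n + 1 + 1 by ring, qPoch_self_succ, qPoch_succ, qPoch_succ]
    rw [one_mul, ← eq_inv_mul_iff_mul_eq₀ (hne n), ← mul_inv]
    ring
  · -- The recurrence passes through sums with `p ^ r * (1 - p ^ (2 * r + 1))` in place of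
    -- `1 - p ^ (4 * r + 2)`, and each of its two halves telescopes in `r`.
    calc _ = -∑ r ∈ range (n + 2), qSign (p ^ 3) r * p ^ r * ((1 - p ^ (4 * r + 2)) -
            (1 + p ^ (2 * n + 1)) * (p ^ r * (1 - p ^ (2 * r + 1)))) * baileyKernel (p ^ 2) n r -
          (1 + p ^ (2 * n + 1)) * ∑ r ∈ range (n + 2), qSign (p ^ 3) r * p ^ r *
            (p ^ r * (1 - p ^ (2 * r + 1)) * baileyKernel (p ^ 2) n r -
              (1 - p ^ (4 * n + 4)) * (1 - p ^ (4 * r + 2)) * baileyKernel (p ^ 2) (n + 1) r) := by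
          rw [mul_sum, ← sum_neg_distrib, ← sum_sub_distrib]
          exact sum_congr rfl fun r _ => by ring
      _ = 0 := by
          rw [sum_range_pentagonal_first hp, sum_range_pentagonal_second hp,
            baileyKernel_of_lt _ (by omega), baileyKernel_of_lt _ (by omega)]
          ring

end Pentagonal

section Chebyshev

/-- The value at `X` of the Chebyshev polynomial `S_r`, that is `sin ((r + 1) θ) / sin θ` for
`X = 2 cos θ`. -/
noncomputable def chebS (X : ℂ) (r : ℤ) : ℂ :=
  (Polynomial.Chebyshev.S ℂ r).eval X

theorem chebS_zero (X : ℂ) : chebS X 0 = 1 := by simp [chebS]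

theorem chebS_neg_one (X : ℂ) : chebS X (-1) = 0 := by simp [chebS]

theorem chebS_add_one (X : ℂ) (r : ℤ) : chebS X (r + 1) = X * chebS X r - chebS X (r - 1) := by
  simp [chebS, Polynomial.Chebyshev.S_add_one]

theorem chebS_one (X : ℂ) : chebS X 1 = X := by simp [chebS]

theorem chebS_two (X : ℂ) : chebS X 2 = X ^ 2 - 1 := by simp [chebS, Polynomial.Chebyshev.S_two]

theorem chebS_three (X : ℂ) : chebS X 3 = X ^ 3 - 2 * X := by
  rw [show (3 : ℤ) = 2 + 1 by rfl, chebS_add_one, chebS_two, show (2 : ℤ) - 1 = 1 by rfl, chebS_one]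
  ring

theorem periodic_chebS_neg_one : Function.Periodic (chebS (-1)) 3 := fun r => by
  rw [show r + 3 = r + 1 + 1 + 1 by ring, chebS_add_one, chebS_add_one _ (r + 1),
    add_sub_cancel_right, add_sub_cancel_right]
  ring

theorem antiperiodic_chebS_zero : Function.Antiperiodic (chebS 0) 2 := fun r => by
  rw [show r + 2 = r + 1 + 1 by ring, chebS_add_one, add_sub_cancel_right]
  ring

theorem chebS_neg_one_three_mul_add (m j : ℕ) : chebS (-1) ↑(3 * m + j) = chebS (-1) j := by
  simpa [add_comm, mul_comm] using periodic_chebS_neg_one.nat_mul m j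

theorem chebS_zero_four_mul_add (m j : ℕ) : chebS 0 ↑(4 * m + j) = chebS 0 j := by
  simpa [add_comm, mul_comm] using antiperiodic_chebS_zero.periodic_two_mul.nat_mul m j

theorem chebS_neg_two_add (r : ℕ) : chebS (-2) r + chebS (-2) (r - 1) = (-1) ^ r := by
  induction r with
  | zero => simp [chebS_zero, chebS_neg_one]
  | succ r ih =>
    push_cast
    rw [chebS_add_one, add_sub_cancel_right, pow_succ, ← ih]
    ring

theorem norm_chebS_le_and (X : ℂ) (r : ℕ) :
    ‖chebS X r‖ ≤ (‖X‖ + 1) ^ r ∧ ‖chebS X (r - 1)‖ ≤ (‖X‖ + 1) ^ r := by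
  induction r with
  | zero => simp [chebS_zero, chebS_neg_one]
  | succ r ih =>
    push_cast
    rw [chebS_add_one, add_sub_cancel_right]
    constructor
    · calc _ ≤ ‖X‖ * ‖chebS X r‖ + ‖chebS X (r - 1)‖ := norm_mul X _ ▸ norm_sub_le _ _
        _ ≤ ‖X‖ * (‖X‖ + 1) ^ r + (‖X‖ + 1) ^ r := by gcongr; exacts [ih.1, ih.2]
        _ = (‖X‖ + 1) ^ (r + 1) := by ring
    · exact ih.1.trans (pow_le_pow_right₀ (by simp) r.le_succ)

end Chebyshev

section Summability

variable {q : ℂ} (hq : ‖q‖ < 1)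
include hq

theorem summable_pow_mul_of_norm_le_geometric {e : ℕ → ℕ} (he : ∀ r, r ^ 2 ≤ e r) {a : ℕ → ℂ}
    {B C : ℝ} (ha : ∀ r, ‖a r‖ ≤ C * B ^ r) : Summable fun r => q ^ e r * a r := by
  have hlim : Tendsto (fun r : ℕ => ‖q‖ ^ r * |B|) atTop (𝓝 0) := by
    simpa using (tendsto_pow_atTop_nhds_zero_of_lt_one (norm_nonneg q) hq).mul_const |B|
  refine Summable.of_norm_bounded_eventually_nat (summable_geometric_two.mul_left |C|) ?_
  filter_upwards [hlim.eventually_le_const one_half_pos] with r hr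
  calc ‖q ^ e r * a r‖ ≤ ‖q‖ ^ r ^ 2 * (|C| * |B| ^ r) := by
        rw [norm_mul, norm_pow, ← abs_pow, ← abs_mul]
        gcongr ?_ * ?_
        · exact pow_le_pow_of_le_one (norm_nonneg q) hq.le (he r)
        · exact (ha r).trans (le_abs_self _)
    _ = |C| * (‖q‖ ^ r * |B|) ^ r := by ring
    _ ≤ |C| * (1 / 2) ^ r := by gcongr

theorem summable_pow_of_sq_le {e : ℕ → ℕ} (he : ∀ r, r ^ 2 ≤ e r) : Summable fun r => q ^ e r := by
  simpa using summable_pow_mul_of_norm_le_geometric hq he (a := 1) (B := 1) (C := 1) (by simp)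

end Summability

section TripleProductSeries

theorem qSign_mul_pow (q : ℂ) (r : ℕ) : qSign q r * q ^ r = (-1) ^ r * q ^ (r * (r + 1) / 2) := by
  rw [qSign, mul_assoc, ← pow_add, Nat.choose_two_right, ← Nat.triangle_succ, add_tsub_cancel_right,
    mul_comm r]

theorem qSign_mul_pow_sq (q : ℂ) (r : ℕ) : (qSign q r * q ^ r) ^ 2 = q ^ (r ^ 2 + r) := by
  rw [qSign_mul_pow, mul_pow, ← pow_mul, ← pow_mul, mul_comm r 2, pow_mul, neg_one_sq, one_pow,
    one_mul, Nat.div_two_mul_two_of_even (Nat.even_mul_succ_self r), mul_add_one, sq]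

variable {q : ℂ} (hq : ‖q‖ < 1) (X : ℂ)
include hq

theorem isBaileyPair_chebS :
    IsBaileyPair q (fun r => qSign q r * q ^ r * (chebS X r + chebS X (r - 1)))
      (fun n => symmQPoch X q n / qPoch q q (2 * n + 1)) := by
  refine isBaileyPair_symmQPoch hq (by simp [chebS_zero, chebS_neg_one])
    (by simp [chebS_zero, chebS_one, add_comm]) fun r => ?_
  push_cast
  rw [show (r : ℤ) + 2 = r + 1 + 1 by ring, add_sub_cancel_right, add_sub_cancel_right,
    chebS_add_one X (r + 1), chebS_add_one X r, add_sub_cancel_right]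
  ring

theorem summable_pow_mul_mul_chebS {e : ℕ → ℕ} (he : ∀ r, r ^ 2 ≤ e r) {b : ℕ → ℂ} {C : ℝ}
    (hb : ∀ r, ‖b r‖ ≤ C) : Summable fun r : ℕ => q ^ e r * (b r * chebS X r) :=
  summable_pow_mul_of_norm_le_geometric hq he fun r => by
    rw [norm_mul]
    exact mul_le_mul (hb r) (norm_chebS_le_and X r).1 (norm_nonneg _)
      ((norm_nonneg _).trans (hb r))

theorem hasSum_symmQPoch :
    HasSum (fun n => baileyWeight q n * (symmQPoch X q n / qPoch q q (2 * n + 1)))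
      (∑' r : ℕ, q ^ (r ^ 2 + r) * (chebS X r + chebS X (r - 1))) := by
  refine (isBaileyPair_chebS hq X).hasSum hq ?_
  have hsum : Summable fun r : ℕ => q ^ (r ^ 2 + r) * (chebS X r + chebS X (r - 1)) := by
    refine summable_pow_mul_of_norm_le_geometric hq (fun r => Nat.le_add_right _ r) (B := ‖X‖ + 1)
      (C := 2) fun r => (norm_add_le _ _).trans ?_
    linarith [norm_chebS_le_and X r]
  exact hsum.hasSum.congr_fun fun r => by rw [← qSign_mul_pow_sq]; ring

theorem isBaileyPair_chebS_div_one_add_pow {v : ℕ → ℂ} (h0 : v 0 = 0)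
    (hv : ∀ r : ℕ, (1 + q ^ (r + 1)) * v (r + 1) = chebS X r) :
    IsBaileyPair q (fun r => qSign q r * q ^ r * (v (r + 1) + q ^ r * v r))
      (fun n => symmQPoch X q n / qPoch q q (2 * n + 1) / (1 + q ^ (n + 1))) := by
  refine IsBaileyPair.div_one_add_pow hq h0 ?_
  convert isBaileyPair_chebS hq X using 3 with r
  cases r with
  | zero => simpa [h0, chebS_neg_one] using hv 0
  | succ r => simpa [hv r] using hv (r + 1)

theorem exists_norm_inv_one_add_pow_le : ∃ C, ∀ n, ‖(1 + q ^ n)⁻¹‖ ≤ C := by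
  have hlim : Tendsto (fun n => (1 + q ^ n)⁻¹) atTop (𝓝 1) := by
    simpa using ((tendsto_pow_atTop_nhds_zero_of_norm_lt_one hq).const_add 1).inv₀ (by simp)
  simpa using (Metric.isBounded_range_of_tendsto _ hlim).exists_norm_le

theorem summable_pow_mul_chebS :
    Summable fun r : ℕ => q ^ (r ^ 2 + r) * ((1 - q ^ (r + 1) + q ^ (2 * r + 2)) * chebS X r) := by
  refine summable_pow_mul_mul_chebS hq X (fun r => Nat.le_add_right _ r) (C := 3) fun r => ?_
  have hle (n : ℕ) : ‖q ^ n‖ ≤ 1 := norm_pow q n ▸ pow_le_one₀ (norm_nonneg q) hq.le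
  calc _ ≤ ‖(1 : ℂ)‖ + ‖q ^ (r + 1)‖ + ‖q ^ (2 * r + 2)‖ :=
        (norm_add_le _ _).trans (by gcongr; exact norm_sub_le _ _)
    _ ≤ 3 := by linarith [norm_one (α := ℂ), hle (r + 1), hle (2 * r + 2)]

theorem hasSum_symmQPoch_div_one_add_pow :
    HasSum
      (fun n => baileyWeight q n * (symmQPoch X q n / qPoch q q (2 * n + 1) / (1 + q ^ (n + 1))))
      (∑' r : ℕ, q ^ (r ^ 2 + r) * ((1 - q ^ (r + 1) + q ^ (2 * r + 2)) * chebS X r)) := by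
  obtain ⟨C, hC⟩ := exists_norm_inv_one_add_pow_le hq
  let v : ℕ → ℂ := fun r => r.casesOn 0 fun s => (1 + q ^ (s + 1))⁻¹ * chebS X s
  have hv (r : ℕ) : (1 + q ^ (r + 1)) * v (r + 1) = chebS X r :=
    mul_inv_cancel_left₀ (one_add_pow_ne_zero hq _) _
  have hfst : Summable fun r => q ^ (r ^ 2 + r) * v (r + 1) :=
    summable_pow_mul_mul_chebS hq X (fun r => by omega) fun r => hC (r + 1)
  have hsnd : Summable fun r => q ^ ((r + 1) ^ 2 + 2 * (r + 1)) * v (r + 1) :=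
    summable_pow_mul_mul_chebS hq X (fun r => by nlinarith) fun r => hC (r + 1)
  have hshift : HasSum (fun r => q ^ (r ^ 2 + 2 * r) * v r)
      (∑' r, q ^ ((r + 1) ^ 2 + 2 * (r + 1)) * v (r + 1)) := by
    simpa [v] using (hasSum_nat_add_iff (f := fun r => q ^ (r ^ 2 + 2 * r) * v r) 1).mp hsnd.hasSum
  refine (isBaileyPair_chebS_div_one_add_pow hq X rfl hv).hasSum hq ?_
  -- The two series combine through `1 + y ^ 3 = (1 + y) * (1 - y + y ^ 2)` at `y = q ^ (r + 1)`.
  convert hfst.hasSum.add hshift using 1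
  · funext r
    linear_combination (v (r + 1) + q ^ r * v r) * qSign_mul_pow_sq q r
  · rw [← hfst.tsum_add hsnd]
    refine tsum_congr fun r => ?_
    rw [← hv r]
    ring

end TripleProductSeries

section ProductIdentities

theorem qPoch_cube (q : ℂ) (n : ℕ) :
    qPoch (q ^ 3) (q ^ 3) n = qPoch q q n * symmQPoch (-1) q n := by
  simp only [qPoch, symmQPoch, ← prod_mul_distrib]
  exact prod_congr rfl fun k _ => by ring

theorem qPoch_neg_sq (q : ℂ) (n : ℕ) : qPoch (-q ^ 2) (q ^ 2) n = symmQPoch 0 q n :=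
  prod_congr rfl fun k _ => by ring

theorem qPoch_neg_self_sq (q : ℂ) (n : ℕ) : qPoch (-q) q n ^ 2 = symmQPoch (-2) q n := by
  rw [qPoch, ← prod_pow]
  exact prod_congr rfl fun k _ => by ring

theorem qPoch_self_two_mul_succ (q : ℂ) (n : ℕ) :
    qPoch q q (2 * n + 1) = qPoch q (q ^ 2) (n + 1) * (qPoch q q n * qPoch (-q) q n) := by
  induction n with
  | zero => simp [qPoch]
  | succ n ih =>
    rw [show 2 * (n + 1) + 1 = 2 * n + 1 + 1 + 1 by ring, qPoch_self_succ, qPoch_self_succ, ih,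
      qPoch_succ q (q ^ 2) (n + 1), qPoch_self_succ q n, qPoch_succ (-q)]
    ring

theorem qPoch_self_two_mul_add_two (q : ℂ) (n : ℕ) :
    qPoch q q (2 * n + 2) = qPoch q q (2 * n + 1) * ((1 + q ^ (n + 1)) * (1 - q ^ (n + 1))) := by
  rw [qPoch_self_succ]
  ring

end ProductIdentities

theorem hasSum_sum_range_mul_add {M : Type*} [AddCommMonoid M] [TopologicalSpace M]
    [ContinuousAdd M] [RegularSpace M] {f : ℕ → M} {S : M} (hf : HasSum f S) (N : ℕ) [NeZero N] :
    HasSum (fun m => ∑ j ∈ range N, f (N * m + j)) S := by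
  convert ((Nat.divModEquiv N).symm.hasSum_iff.mpr hf).prod_fiberwise fun m => hasSum_fintype _
    using 2 with m
  simp [← Fin.sum_univ_eq_sum_range (fun j => f (N * m + j)), Nat.divModEquiv, mul_comm]

theorem pow_mul_one_sub_zpow (q : ℂ) {a b : ℕ} {c : ℤ} (ha : a ≠ 0) (hb : b ≠ 0)
    (h : (b : ℤ) = a + c) : q ^ a * (1 - q ^ c) = q ^ a - q ^ b := by
  rcases eq_or_ne q 0 with rfl | hq
  · simp [ha, hb]
  · rw [mul_sub, mul_one, ← zpow_natCast q b, h, zpow_add₀ hq, zpow_natCast]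

theorem two_mul_choose_two_add_self (r : ℕ) : 2 * r.choose 2 + r = r ^ 2 := by
  induction r with
  | zero => rfl
  | succ r ih =>
    rw [Nat.choose_succ_succ', Nat.choose_one_right]
    linarith

theorem sq_le_five_mul_choose_two_add (r : ℕ) : r ^ 2 ≤ 5 * r.choose 2 + 3 * r := by
  have := two_mul_choose_two_add_self r
  omega

section FalseThetaSeries

variable {q : ℂ} (hq : ‖q‖ < 1)
include hq

theorem summable_pow_mul_one_sub_pow {a : ℕ → ℕ} (ha : ∀ r, r ^ 2 ≤ a r) (b : ℕ → ℕ) :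
    Summable fun r => q ^ a r * (1 - q ^ b r) := by
  simp only [mul_sub, mul_one, ← pow_add]
  exact (summable_pow_of_sq_le hq ha).sub
    (summable_pow_of_sq_le hq fun r => (ha r).trans (Nat.le_add_right _ _))

theorem summable_pow_mul_one_sub_zpow {a : ℕ → ℕ} (b : ℕ → ℕ) {c : ℕ → ℤ}
    (ha : ∀ r, r ^ 2 < a r) (hb : ∀ r, r ^ 2 < b r) (h : ∀ r, (b r : ℤ) = a r + c r) :
    Summable fun r => q ^ a r * (1 - q ^ c r) := by
  simp only [pow_mul_one_sub_zpow q (ha _).ne_bot (hb _).ne_bot (h _)]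
  exact (summable_pow_of_sq_le hq fun r => (ha r).le).sub
    (summable_pow_of_sq_le hq fun r => (hb r).le)

theorem tsum_pow_mul_chebS_neg_one :
    ∑' r : ℕ, q ^ (r ^ 2 + r) * ((1 - q ^ (r + 1) + q ^ (2 * r + 2)) * chebS (-1) r) =
      ∑' r : ℕ, q ^ (9 * r ^ 2 + 3 * r) * (1 - q ^ (12 * r + 6)) +
      ∑' r : ℕ, q ^ (9 * r ^ 2 + 12 * r + 4) * (1 - q ^ (-6 * (r : ℤ) - 3)) := by
  rw [← (hasSum_sum_range_mul_add (summable_pow_mul_chebS hq (-1)).hasSum 3).tsum_eq,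
    ← (summable_pow_mul_one_sub_pow hq (fun r => by omega) _).tsum_add
      (summable_pow_mul_one_sub_zpow hq (fun r => 9 * r ^ 2 + 6 * r + 1) (fun r => by omega)
        (fun r => by omega) fun r => by push_cast; ring)]
  refine tsum_congr fun m => ?_
  rw [pow_mul_one_sub_zpow q (b := 9 * m ^ 2 + 6 * m + 1) (by omega) (by omega)
    (by push_cast; ring)]
  simp only [chebS_neg_one_three_mul_add, sum_range_succ, sum_range_zero, Nat.cast_zero,
    Nat.cast_one, Nat.cast_ofNat, chebS_zero, chebS_one, chebS_two]
  ring

theorem tsum_pow_mul_chebS_zero :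
    ∑' r : ℕ, q ^ (r ^ 2 + r) * ((1 - q ^ (r + 1) + q ^ (2 * r + 2)) * chebS 0 r) =
      ∑' r : ℕ, q ^ (16 * r ^ 2 + 4 * r) * (1 - q ^ (24 * r + 12)) -
      ∑' r : ℕ, q ^ (16 * r ^ 2 + 8 * r + 1) * (1 - q ^ (16 * r + 8)) +
      ∑' r : ℕ, q ^ (16 * r ^ 2 + 12 * r + 2) * (1 - q ^ (8 * r + 4)) := by
  have hfst : Summable fun r : ℕ => q ^ (16 * r ^ 2 + 4 * r) * (1 - q ^ (24 * r + 12)) :=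
    summable_pow_mul_one_sub_pow hq (fun r => by omega) _
  have hsnd : Summable fun r : ℕ => q ^ (16 * r ^ 2 + 8 * r + 1) * (1 - q ^ (16 * r + 8)) :=
    summable_pow_mul_one_sub_pow hq (fun r => by omega) _
  have htrd : Summable fun r : ℕ => q ^ (16 * r ^ 2 + 12 * r + 2) * (1 - q ^ (8 * r + 4)) :=
    summable_pow_mul_one_sub_pow hq (fun r => by omega) _
  rw [← (hasSum_sum_range_mul_add (summable_pow_mul_chebS hq 0).hasSum 4).tsum_eq,
    ← hfst.tsum_sub hsnd, ← (hfst.sub hsnd).tsum_add htrd]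
  refine tsum_congr fun m => ?_
  simp only [chebS_zero_four_mul_add, sum_range_succ, sum_range_zero, Nat.cast_zero,
    Nat.cast_one, Nat.cast_ofNat, chebS_zero, chebS_one, chebS_two, chebS_three]
  ring

theorem tsum_pow_five_mul_choose_two_add :
    ∑' r : ℕ, q ^ (5 * r.choose 2 + 3 * r) * (1 - q ^ (4 * r + 2)) =
      ∑' r : ℕ, q ^ (10 * r ^ 2 + r) * (1 - q ^ (18 * r + 9)) +
      ∑' r : ℕ, q ^ (10 * r ^ 2 + 11 * r + 3) * (1 - q ^ (-2 * (r : ℤ) - 1)) := by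
  have heven (m : ℕ) : 5 * (2 * m).choose 2 + 3 * (2 * m) = 10 * m ^ 2 + m := by
    linarith [two_mul_choose_two_add_self (2 * m)]
  have hodd (m : ℕ) : 5 * (2 * m + 1).choose 2 + 3 * (2 * m + 1) = 10 * m ^ 2 + 11 * m + 3 := by
    linarith [two_mul_choose_two_add_self (2 * m + 1)]
  have hsum := summable_pow_mul_one_sub_pow hq sq_le_five_mul_choose_two_add fun r => 4 * r + 2
  rw [← (hasSum_sum_range_mul_add hsum.hasSum 2).tsum_eq,
    ← (summable_pow_mul_one_sub_pow hq (fun r => by omega) _).tsum_add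
      (summable_pow_mul_one_sub_zpow hq (fun r => 10 * r ^ 2 + 9 * r + 2) (fun r => by omega)
        (fun r => by omega) fun r => by push_cast; ring)]
  refine tsum_congr fun m => ?_
  rw [pow_mul_one_sub_zpow q (b := 10 * m ^ 2 + 9 * m + 2) (by omega) (by omega)
    (by push_cast; ring), sum_range_succ, sum_range_one, add_zero, heven, hodd]
  ring

theorem hasSum_falseTheta_nine :
    HasSum
      (fun n : ℕ => (1 - q ^ (n + 1)) * qPoch (q ^ 3) (q ^ 3) n * (-1) ^ n *
        q ^ (n * (n + 1) / 2) / qPoch q q (2 * n + 2))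
      (∑' r : ℕ, q ^ (9 * r ^ 2 + 3 * r) * (1 - q ^ (12 * r + 6)) +
        ∑' r : ℕ, q ^ (9 * r ^ 2 + 12 * r + 4) * (1 - q ^ (-6 * (r : ℤ) - 3))) := by
  rw [← tsum_pow_mul_chebS_neg_one hq]
  refine (hasSum_symmQPoch_div_one_add_pow hq (-1)).congr_fun fun n => ?_
  have := one_sub_pow_succ_ne_zero hq n
  rw [qPoch_cube, qPoch_self_two_mul_add_two, baileyWeight, qSign_mul_pow]
  field_simp

theorem hasSum_falseTheta_ten :
    HasSum (fun n : ℕ => (-1) ^ n * q ^ (n ^ 2 + n) / qPoch (-q) q (2 * n))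
      (∑' r : ℕ, q ^ (10 * r ^ 2 + r) * (1 - q ^ (18 * r + 9)) +
        ∑' r : ℕ, q ^ (10 * r ^ 2 + 11 * r + 3) * (1 - q ^ (-2 * (r : ℤ) - 1))) := by
  rw [← tsum_pow_five_mul_choose_two_add hq]
  have hsum := (summable_pow_mul_one_sub_pow hq sq_le_five_mul_choose_two_add
    fun r => 4 * r + 2).hasSum
  refine ((isBaileyPair_pentagonal hq).hasSum (norm_sq_lt_one hq)
    (hsum.congr_fun fun r => ?_)).congr_fun fun n => ?_
  · linear_combination q ^ (3 * r) * (1 - q ^ (4 * r + 2)) * qSign_mul_qSign (q ^ 2) (q ^ 3) r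
  · have := qPoch_self_ne_zero (norm_sq_lt_one hq) n
    rw [baileyWeight, qSign_mul_pow, ← pow_mul,
      Nat.two_mul_div_two_of_even (Nat.even_mul_succ_self n), mul_add_one, ← sq]
    field_simp

theorem hasSum_falseTheta_sixteen :
    HasSum
      (fun n : ℕ => qPoch q q (n + 1) * qPoch (-q ^ 2) (q ^ 2) n * (-1) ^ n *
        q ^ ((n ^ 2 + n) / 2) / qPoch q q (2 * n + 2))
      (∑' r : ℕ, q ^ (16 * r ^ 2 + 4 * r) * (1 - q ^ (24 * r + 12)) -
        ∑' r : ℕ, q ^ (16 * r ^ 2 + 8 * r + 1) * (1 - q ^ (16 * r + 8)) +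
        ∑' r : ℕ, q ^ (16 * r ^ 2 + 12 * r + 2) * (1 - q ^ (8 * r + 4))) := by
  rw [← tsum_pow_mul_chebS_zero hq]
  refine (hasSum_symmQPoch_div_one_add_pow hq 0).congr_fun fun n => ?_
  have := one_sub_pow_succ_ne_zero hq n
  rw [qPoch_neg_sq, qPoch_self_succ, qPoch_self_two_mul_add_two, baileyWeight, qSign_mul_pow,
    sq n, ← mul_add_one]
  field_simp

theorem hasSum_falseTheta_triangular :
    HasSum
      (fun n : ℕ => qPoch (-q) q n * q ^ (n * (n + 1) / 2) * (-1) ^ n / qPoch q (q ^ 2) (n + 1))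
      (∑' r : ℕ, (-1) ^ r * q ^ (r ^ 2 + r)) := by
  convert hasSum_symmQPoch hq (-2) using 1
  · funext n
    have := qPoch_self_ne_zero hq n
    have := qPoch_neg_self_ne_zero hq n
    rw [← qPoch_neg_self_sq, qPoch_self_two_mul_succ, baileyWeight, qSign_mul_pow]
    field_simp
  · simp only [chebS_neg_two_add, mul_comm]

end FalseThetaSeries

theorem corollary3p7 (q : ℂ) (hq : ‖q‖ < 1) :
    -- first identity
    ((Summable fun n : ℕ => (1 - q ^ (n + 1)) * qPoch (q ^ 3) (q ^ 3) n * (-1) ^ n *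
          q ^ (n * (n + 1) / 2) / qPoch q q (2 * n + 2)) ∧
      (Summable fun r : ℕ => q ^ (9 * r ^ 2 + 3 * r) * (1 - q ^ (12 * r + 6))) ∧
      (Summable fun r : ℕ =>
          q ^ (9 * r ^ 2 + 12 * r + 4) * (1 - q ^ (-6 * (r : ℤ) - 3))) ∧
      ∑' n : ℕ, (1 - q ^ (n + 1)) * qPoch (q ^ 3) (q ^ 3) n * (-1) ^ n *
          q ^ (n * (n + 1) / 2) / qPoch q q (2 * n + 2) =
        ∑' r : ℕ, q ^ (9 * r ^ 2 + 3 * r) * (1 - q ^ (12 * r + 6)) +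
        ∑' r : ℕ, q ^ (9 * r ^ 2 + 12 * r + 4) * (1 - q ^ (-6 * (r : ℤ) - 3))) ∧
    -- second identity
    ((Summable fun n : ℕ => (-1) ^ n * q ^ (n ^ 2 + n) / qPoch (-q) q (2 * n)) ∧
      (Summable fun r : ℕ => q ^ (10 * r ^ 2 + r) * (1 - q ^ (18 * r + 9))) ∧
      (Summable fun r : ℕ =>
          q ^ (10 * r ^ 2 + 11 * r + 3) * (1 - q ^ (-2 * (r : ℤ) - 1))) ∧
      ∑' n : ℕ, (-1) ^ n * q ^ (n ^ 2 + n) / qPoch (-q) q (2 * n) =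
        ∑' r : ℕ, q ^ (10 * r ^ 2 + r) * (1 - q ^ (18 * r + 9)) +
        ∑' r : ℕ, q ^ (10 * r ^ 2 + 11 * r + 3) * (1 - q ^ (-2 * (r : ℤ) - 1))) ∧
    -- third identity
    ((Summable fun n : ℕ => qPoch q q (n + 1) * qPoch (-q ^ 2) (q ^ 2) n * (-1) ^ n *
          q ^ ((n ^ 2 + n) / 2) / qPoch q q (2 * n + 2)) ∧
      (Summable fun r : ℕ => q ^ (16 * r ^ 2 + 4 * r) * (1 - q ^ (24 * r + 12))) ∧
      (Summable fun r : ℕ => q ^ (16 * r ^ 2 + 8 * r + 1) * (1 - q ^ (16 * r + 8))) ∧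
      (Summable fun r : ℕ => q ^ (16 * r ^ 2 + 12 * r + 2) * (1 - q ^ (8 * r + 4))) ∧
      ∑' n : ℕ, qPoch q q (n + 1) * qPoch (-q ^ 2) (q ^ 2) n * (-1) ^ n *
          q ^ ((n ^ 2 + n) / 2) / qPoch q q (2 * n + 2) =
        ∑' r : ℕ, q ^ (16 * r ^ 2 + 4 * r) * (1 - q ^ (24 * r + 12)) -
        ∑' r : ℕ, q ^ (16 * r ^ 2 + 8 * r + 1) * (1 - q ^ (16 * r + 8)) +
        ∑' r : ℕ, q ^ (16 * r ^ 2 + 12 * r + 2) * (1 - q ^ (8 * r + 4))) ∧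
    -- fourth identity
    ((Summable fun n : ℕ => qPoch (-q) q n * q ^ (n * (n + 1) / 2) * (-1) ^ n /
          qPoch q (q ^ 2) (n + 1)) ∧
      (Summable fun r : ℕ => (-1) ^ r * q ^ (r ^ 2 + r)) ∧
      ∑' n : ℕ, qPoch (-q) q n * q ^ (n * (n + 1) / 2) * (-1) ^ n /
          qPoch q (q ^ 2) (n + 1) =
        ∑' r : ℕ, (-1) ^ r * q ^ (r ^ 2 + r)) := by
  refine ⟨⟨(hasSum_falseTheta_nine hq).summable,
      summable_pow_mul_one_sub_pow hq (fun r => by omega) _,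
      summable_pow_mul_one_sub_zpow hq (fun r => 9 * r ^ 2 + 6 * r + 1) (fun r => by omega)
        (fun r => by omega) fun r => by push_cast; ring,
      (hasSum_falseTheta_nine hq).tsum_eq⟩,
    ⟨(hasSum_falseTheta_ten hq).summable,
      summable_pow_mul_one_sub_pow hq (fun r => by omega) _,
      summable_pow_mul_one_sub_zpow hq (fun r => 10 * r ^ 2 + 9 * r + 2) (fun r => by omega)
        (fun r => by omega) fun r => by push_cast; ring,
      (hasSum_falseTheta_ten hq).tsum_eq⟩,
    ⟨(hasSum_falseTheta_sixteen hq).summable,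
      summable_pow_mul_one_sub_pow hq (fun r => by omega) _,
      summable_pow_mul_one_sub_pow hq (fun r => by omega) _,
      summable_pow_mul_one_sub_pow hq (fun r => by omega) _,
      (hasSum_falseTheta_sixteen hq).tsum_eq⟩,
    (hasSum_falseTheta_triangular hq).summable, ?_, (hasSum_falseTheta_triangular hq).tsum_eq⟩
  simpa only [mul_comm] using summable_pow_mul_of_norm_le_geometric hq (C := 1) (B := 1)
    (fun r => Nat.le_add_right (r ^ 2) r) (a := fun r => (-1) ^ r) (by simp)
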